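/- Consider $n$ devices on a single-hop multiple-access channel without collision detection ($\mathsf{No}\text{-}\mathsf{CD}$). All devices start at the same time and proceed in synchronous rounds; in each round a device transmits a message, listens, or stays idle. A listener receives the message $m$ if exactly one device transmits in that round and its message is $m$, and hears silence if zero or at least two devices transmit; transmitters and idle devices receive no feedback. The devices have distinct identifiers from $[N]=\{1,\dots,N\}$. A deterministic algorithm determines the behaviour of each device from its identifier and from what it has received so far. It solves leader election if all devices terminate in the same round, in which the leader transmits and every other device listens, and after it exactly one device identifies itself as the leader while all others identify themselves as non-leaders. The time is the number of rounds until termination, and the energy is the maximum, over all devices, of the number of rounds in which the device is not idle. Write $\log^{+} x=\max\{1,\log_2 x\}$. There is an absolute constant $C>0$ such that for all integers $N$ and $\tilde n$ (both known to all devices) there is a deterministic $\mathsf{No}\text{-}\mathsf{CD}$ algorithm with the following property. For every set $S\subseteq[N]$ of $n=|S|$ devices with $\tilde n/2<n\le\tilde n$, the algorithm run by the devices of $S$ solves leader election in time at most $C\,n\log^{+}\frac{N}{n}$ and with energy at most $C\log^{+}\frac{N}{n}$. In particular, for $n\le N/2$ the time is $O\left(n\log\frac{N}{n}\right)$ and the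 energy is $O\left(\log\frac{N}{n}\right)$. -/

import Mathlib

namespace MultipleAccess

/-- Messages are finite bit strings of arbitrary length. -/
abbrev Msg : Type := List Bool

/-- What a device may do in one communication round. -/
inductive Action : Type where
  | transmit (m : Msg)
  | listen
  | idle
  deriving DecidableEq

/-- The message sent by an action, if the action is a transmission. -/
def Action.message? : Action → Option Msg
  | .transmit m => some m
  | .listen => none
  | .idle => none

/-- How a device identifies itself when it terminates. -/
inductive Role : Type where
  | leader
  | nonLeader
  deriving DecidableEq

/-- What a device has received so far: one entry per elapsed round, most recent round first.
An entry is `some m` if the device listened in that round and received the message `m`; it is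
`none` if the device listened and the channel was silent, or if it did not listen. (As the device
is deterministic, it can recover its own earlier actions from this record.) -/
abbrev History : Type := List (Option Msg)

/-- A deterministic algorithm for devices with identifiers from an ID space of size `N`.
Given only its own identifier and its history, a device decides whether it has terminated (and
with which role); if it has not, `act` is its action in the next round. -/
structure Algorithm (N : ℕ) where
  output : Fin N → History → Option Role
  act : Fin N → History → Action

open Classical in
/-- The content of the channel in the model without collision detection, when the devices in `S`
perform the actions `a`: the message `m` if exactly one device transmits and it sends `m`, and
silence (`none`) if zero or at least two devices transmit. -/
noncomputable def channel {N : ℕ} (S : Finset (Fin N)) (a : Fin N → Action) : Option Msg :=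
  if h : ∃! u, u ∈ S ∧ ∃ m, a u = Action.transmit m then (a h.choose).message? else none

/-- The feedback to a device performing the action `a` when the channel content is `c`:
listeners observe the channel, transmitters and idle devices receive no feedback. -/
def feedback (c : Option Msg) (a : Action) : Option Msg :=
  match a with
  | .listen => c
  | .transmit _ => none
  | .idle => none

namespace Algorithm

variable {N : ℕ}

/-- The action of device `v` with history `h`: a terminated device stays idle. -/
def step (A : Algorithm N) (v : Fin N) (h : History) : Action :=
  if A.output v h = none then A.act v h else Action.idle

/-- The history of device `v` after `t` rounds, when the set of devices in the network is `S`. -/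
noncomputable def history (A : Algorithm N) (S : Finset (Fin N)) : ℕ → Fin N → History
  | 0, _ => []
  | t + 1, v =>
      feedback (channel S (fun u => A.step u (A.history S t u))) (A.step v (A.history S t v))
        :: A.history S t v

/-- The action of device `v` in round `t` (rounds are numbered `0, 1, 2, …`). -/
noncomputable def action (A : Algorithm N) (S : Finset (Fin N)) (t : ℕ) (v : Fin N) : Action :=
  A.step v (A.history S t v)

/-- The energy cost of device `v` in the first `T` rounds: the number of non-idle rounds. -/
noncomputable def energy (A : Algorithm N) (S : Finset (Fin N)) (T : ℕ) (v : Fin N) : ℕ :=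
  ((Finset.range T).filter fun t => A.action S t v ≠ Action.idle).card

/-- When run on the set `S` of devices, `A` solves leader election in exactly `T` rounds:
all devices terminate in the same round, the `T`-th one (whose number is `T - 1`), in which the
leader transmits and all the other devices listen; then exactly one device identifies itself as
the leader and all the others identify themselves as non-leaders. -/
def ElectsLeader (A : Algorithm N) (S : Finset (Fin N)) (T : ℕ) : Prop :=
  0 < T ∧
  (∀ t < T, ∀ v ∈ S, A.output v (A.history S t v) = none) ∧
  ∃ l ∈ S,
    A.output l (A.history S T l) = some Role.leader ∧
    (∃ m, A.action S (T - 1) l = Action.transmit m) ∧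
    ∀ v ∈ S, v ≠ l →
      A.output v (A.history S T v) = some Role.nonLeader ∧
      A.action S (T - 1) v = Action.listen

end Algorithm

end MultipleAccess

/-!
The election is a queue of duties. Time is divided into slots of four rounds. In every slot each
device has a part, fixed in advance by its identifier: to call, to answer, or (mostly) to sleep. A
device that joins the queue gets an interval of `B` slots in which it is on duty; the intervals are
assigned one after the other, so that at most one device is on duty at any time. If a device is on
duty, a fresh device that is the only caller of a slot joins: its call is received and confirmed by
the device on duty, together with the end `tail` of the queue, where its own duty will start. If the
queue has run dry, a single caller can still join if there is exactly one answerer, who confirms the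
call in place of the device on duty. The device on duty after the last slot is the leader
(`electsLeader`). The energy of a device is proportional to the number of its active slots plus `B`
(`energy_le`).

Every joining device advances `tail` by at least `B`, and this is all that matters
(`Queue.Valid.tail_ge`): it is irrelevant when the devices join and how often the queue runs dry. If
`G` devices have joined and `B * G` exceeds the number `T` of slots, somebody is on duty at the end.

It remains to find a schedule of parts, for `q = n'` and `l` about `log (N / q)`, in which all sets
of about `q` devices make sufficiently many joins (`exists_schedule`). If every device calls with
probability `1 / (4 q)` in a slot and answers with the same probability, then exactly one fresh
device calls and exactly one answers with constant probability (`card_isolates`), as long as there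
are at least `q / 8` fresh devices. So it is exponentially unlikely in `T = Θ(q l)` that fewer than
`q / 16 + 1` devices join, which beats the number `2 ^ O(q l)` of possible sets. At the same time the
expected number of devices that are active in more than `Θ(l)` slots is below `q / 4`; these
overloaded devices stay out of the election, and the union bound covers the sets without them. The
probabilistic argument is carried out by the method of conditional expectations, slot by slot, so
that only averages over a single row of parts are needed.
-/

namespace MultipleAccess

/-! ### The channel -/

variable {N : ℕ}

theorem channel_eq_some {S : Finset (Fin N)} {a : Fin N → Action} {u : Fin N} {m : Msg}
    (hu : u ∈ S) (ha : a u = .transmit m)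
    (huniq : ∀ v ∈ S, ∀ m', a v = .transmit m' → v = u) : channel S a = some m := by
  have h : ∃! u, u ∈ S ∧ ∃ m, a u = Action.transmit m :=
    ⟨u, ⟨hu, m, ha⟩, fun v ⟨hv, m', hm'⟩ => huniq v hv m' hm'⟩
  have hc : h.choose = u := h.unique h.choose_spec.1 ⟨hu, m, ha⟩
  rw [channel, dif_pos h, hc, ha]
  rfl

theorem channel_eq_none {S : Finset (Fin N)} {a : Fin N → Action}
    (h : ¬ ∃! u, u ∈ S ∧ ∃ m, a u = .transmit m) : channel S a = none := by
  rw [channel, dif_neg h]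

/-- If the transmitters are exactly the members of `R`, and all of them send `m`, then `m` is
received iff `R` is a singleton. -/
theorem channel_eq_ite {S R : Finset (Fin N)} {a : Fin N → Action} {m : Msg} (hRS : R ⊆ S)
    (hR : ∀ v ∈ R, a v = .transmit m) (hS : ∀ v ∈ S, ∀ m', a v = .transmit m' → v ∈ R) :
    channel S a = if R.card = 1 then some m else none := by
  split_ifs with h
  · obtain ⟨u, rfl⟩ := Finset.card_eq_one.1 h
    exact channel_eq_some (hRS (by simp)) (hR u (by simp))
      fun v hv m' hm' => by simpa using hS v hv m' hm'
  · refine channel_eq_none fun ⟨u, ⟨huS, m', hm'⟩, hu⟩ => h (Finset.card_eq_one.2 ⟨u, ?_⟩)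
    refine Finset.eq_singleton_iff_unique_mem.2 ⟨hS u huS m' hm', fun v hv => ?_⟩
    exact hu v ⟨hRS hv, m, hR v hv⟩

/-! ### The queue of duty intervals -/

/-- What a participant is asked to do in a slot as long as it has not joined the queue. -/
inductive Part : Type where
  | call
  | answer
  | sleep
  deriving DecidableEq

/-- The queue as seen by an outside observer. A device `v` that has joined is on duty in the slots
`s, …, s + B - 1` where `start v = some s` and `B` is the fixed duty length; `tail` is the first
slot after all duties assigned so far. -/
structure Queue (N : ℕ) where
  start : Fin N → Option ℕ
  tail : ℕ

namespace Queue

/-- Nobody has joined. -/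
def empty : Queue N := ⟨fun _ => none, 0⟩

/-- The members of `S` that have not joined and have part `x`. -/
def fresh (σ : Queue N) (S : Finset (Fin N)) (part : Fin N → Part) (x : Part) :
    Finset (Fin N) :=
  S.filter fun v => σ.start v = none ∧ part v = x

/-- A device joins in slot `t` if it is the only fresh caller and either somebody is on duty or
there is exactly one fresh answerer. -/
def Joins (σ : Queue N) (S : Finset (Fin N)) (t : ℕ) (part : Fin N → Part) : Prop :=
  (σ.fresh S part .call).card = 1 ∧ (t < σ.tail ∨ (σ.fresh S part .answer).card = 1)

instance (σ : Queue N) (S : Finset (Fin N)) (t : ℕ) (part : Fin N → Part) :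
    Decidable (σ.Joins S t part) :=
  inferInstanceAs (Decidable (_ ∧ _))

/-- The queue after slot `t`. The joining device is put on duty right after the last duty assigned,
but not before slot `t + 1`. -/
def next (B : ℕ) (S : Finset (Fin N)) (t : ℕ) (part : Fin N → Part) (σ : Queue N) : Queue N :=
  if σ.Joins S t part then
    ⟨fun v => if v ∈ σ.fresh S part .call then some (max σ.tail (t + 1)) else σ.start v,
      max σ.tail (t + 1) + B⟩
  else σ

/-- The queue before slot `t`. -/
def run (B : ℕ) (S : Finset (Fin N)) (part : ℕ → Fin N → Part) : ℕ → Queue N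
  | 0 => empty
  | t + 1 => (run B S part t).next B S t (part t)

/-- The devices that have joined. -/
def joined (σ : Queue N) : Finset (Fin N) :=
  Finset.univ.filter fun v => σ.start v ≠ none

theorem card_joined_next (B : ℕ) (S : Finset (Fin N)) (t : ℕ) (part : Fin N → Part)
    (σ : Queue N) : (σ.next B S t part).joined.card =
      σ.joined.card + if σ.Joins S t part then 1 else 0 := by
  by_cases h : σ.Joins S t part
  · obtain ⟨u, hu⟩ := Finset.card_eq_one.1 h.1
    have hmem : u ∈ σ.fresh S part .call := by simp [hu]
    have hfresh : σ.start u = none := by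
      simp only [fresh, Finset.mem_filter] at hmem
      exact hmem.2.1
    have : (σ.next B S t part).joined = insert u σ.joined := by
      ext v
      by_cases hv : v = u <;> simp [joined, next, h, hu, hv]
    rw [this, Finset.card_insert_of_notMem (by simp [joined, hfresh]), if_pos h]
  · simp [next, h]

/-- The facts about the queue before slot `t` on which the protocol relies: the duties lie before
`tail`, they are disjoint, and they cover the slots from `t` to `tail`. -/
structure Valid (B : ℕ) (S : Finset (Fin N)) (t : ℕ) (σ : Queue N) : Prop where
  mem : ∀ v s, σ.start v = some s → v ∈ S
  le_tail : ∀ v s, σ.start v = some s → s + B ≤ σ.tail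
  disjoint : ∀ u v s s', σ.start u = some s → σ.start v = some s' → u ≠ v →
    s + B ≤ s' ∨ s' + B ≤ s
  cover : ∀ x, t ≤ x → x < σ.tail → ∃ v s, σ.start v = some s ∧ s ≤ x ∧ x < s + B
  tail_ge : B * σ.joined.card ≤ σ.tail

theorem valid_empty (B : ℕ) (S : Finset (Fin N)) : Valid B S 0 (empty : Queue N) := by
  constructor <;> simp [empty, joined]

theorem Valid.next {B : ℕ} {S : Finset (Fin N)} {t : ℕ} {σ : Queue N} (hσ : Valid B S t σ)
    (part : Fin N → Part) : Valid B S (t + 1) (σ.next B S t part) := by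
  by_cases h : σ.Joins S t part
  swap
  · have : σ.next B S t part = σ := by simp [Queue.next, h]
    rw [this]
    exact ⟨hσ.mem, hσ.le_tail, hσ.disjoint, fun x hx => hσ.cover x (by omega), hσ.tail_ge⟩
  have hcard := card_joined_next B S t part σ
  rw [if_pos h] at hcard
  obtain ⟨u, hu⟩ := Finset.card_eq_one.1 h.1
  have hmem : u ∈ σ.fresh S part .call := by simp [hu]
  simp only [fresh, Finset.mem_filter] at hmem
  have hstart : ∀ v, (σ.next B S t part).start v =
      if v = u then some (max σ.tail (t + 1)) else σ.start v := by
    intro v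
    simp [Queue.next, h, hu]
  have htail : (σ.next B S t part).tail = max σ.tail (t + 1) + B := by
    simp [Queue.next, h]
  refine ⟨?_, ?_, ?_, ?_, ?_⟩
  · intro v s hv
    rw [hstart] at hv
    split_ifs at hv with hvu
    · exact hvu ▸ hmem.1
    · exact hσ.mem v s hv
  · intro v s hv
    rw [hstart] at hv
    rw [htail]
    split_ifs at hv with hvu
    · simp only [Option.some.injEq] at hv
      omega
    · have := hσ.le_tail v s hv
      omega
  · intro v w s s' hv hw hvw
    rw [hstart] at hv hw
    split_ifs at hv hw with h1 h2 h2
    · exact absurd (h1.trans h2.symm) hvw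
    · have := hσ.le_tail w s' hw
      simp only [Option.some.injEq] at hv
      omega
    · have := hσ.le_tail v s hv
      simp only [Option.some.injEq] at hw
      omega
    · exact hσ.disjoint v w s s' hv hw hvw
  · intro x hx hx'
    rw [htail] at hx'
    by_cases hxE : x < σ.tail
    · obtain ⟨v, s, hv, hs⟩ := hσ.cover x (by omega) hxE
      refine ⟨v, s, ?_, hs⟩
      rw [hstart, if_neg, hv]
      rintro rfl
      simp [hmem.2.1] at hv
    · exact ⟨u, max σ.tail (t + 1), by rw [hstart, if_pos rfl], by omega, by omega⟩
  · rw [hcard, htail, mul_add, mul_one]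
    have := hσ.tail_ge
    omega

theorem valid_run (B : ℕ) (S : Finset (Fin N)) (part : ℕ → Fin N → Part) (t : ℕ) :
    Valid B S t (run B S part t) := by
  induction t with
  | zero => exact valid_empty B S
  | succ t ih => exact ih.next (part t)

/-- Members of `S` that always sleep do not affect the queue. -/
theorem run_congr {B : ℕ} {S S' : Finset (Fin N)} {part part' : ℕ → Fin N → Part}
    (h : ∀ t v x, x ≠ Part.sleep → (v ∈ S ∧ part t v = x ↔ v ∈ S' ∧ part' t v = x)) (t : ℕ) :
    run B S part t = run B S' part' t := by
  induction t with
  | zero => rfl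
  | succ t ih =>
    have key : ∀ x, x ≠ Part.sleep → (run B S' part' t).fresh S (part t) x =
        (run B S' part' t).fresh S' (part' t) x := by
      intro x hx
      ext v
      have := h t v x hx
      simp only [fresh, Finset.mem_filter]
      tauto
    have h1 := key .call (by simp)
    have h2 := key .answer (by simp)
    simp only [run, next, Joins, ih, h1, h2]
    congr

end Queue

/-! ### The protocol -/

/-- `OnDuty B t o` says that a device with starting slot `o` is on duty in slot `t`. -/
def OnDuty (B t : ℕ) (o : Option ℕ) : Prop := ∃ s, o = some s ∧ s ≤ t ∧ t < s + B

@[simp] theorem not_onDuty_none (B t : ℕ) : ¬ OnDuty B t none := fun ⟨_, h, _⟩ => nomatch h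

instance (B t : ℕ) : ∀ o : Option ℕ, Decidable (OnDuty B t o)
  | none => isFalse (not_onDuty_none B t)
  | some s => decidable_of_iff (s ≤ t ∧ t < s + B) (by simp [OnDuty])

/-- The memory of a device: the slot in which its duty starts, if it has joined the queue, and what
it believes to be the tail of the queue. -/
structure Device where
  start : Option ℕ
  tail : ℕ

/-- A number sent as a message, in unary. -/
def numMsg (n : ℕ) : Msg := List.replicate n true

@[simp] theorem length_numMsg (n : ℕ) : (numMsg n).length = n := List.length_replicate

namespace Device

/-- The action in round `r` of slot `t` of a device with part `p` that received `last` in the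
preceding round. Every slot has four rounds.
* Round `0`: the device on duty shows its presence to the fresh answerers.
* Round `1`: the fresh callers call; the device on duty listens, and so do the fresh answerers if
  nobody is on duty.
* Round `2`: those who heard a call confirm it by sending the starting slot for the caller's duty.
* Round `3`: the device on duty passes the tail of the queue on to its successor. -/
def act (B : ℕ) (p : Part) (t : ℕ) (d : Device) (last : Option Msg) : ℕ → Action
  | 0 => if OnDuty B t d.start then .transmit [] else
      if d.start = none ∧ p = .answer then .listen else .idle
  | 1 => if OnDuty B t d.start then .listen else
      if d.start = none ∧ p = .call then .transmit [] else
      if d.start = none ∧ p = .answer ∧ last = none then .listen else .idle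
  | 2 => if OnDuty B t d.start then (if last = none then .idle else .transmit (numMsg d.tail)) else
      if d.start = none ∧ p = .call then .listen else
      if d.start = none ∧ p = .answer ∧ last ≠ none then .transmit (numMsg (t + 1)) else .idle
  | _ => if OnDuty B t d.start then .transmit (numMsg d.tail) else
      if d.start = some (t + 1) then .listen else .idle

/-- The memory after round `r` of slot `t`, in which `recv` was received; `last` was received in
the preceding round. -/
def update (B t : ℕ) (d : Device) (last recv : Option Msg) : ℕ → Device
  | 2 => if d.start = none then recv.elim d fun m => ⟨some m.length, m.length + B⟩ else
      if OnDuty B t d.start ∧ last ≠ none then ⟨d.start, d.tail + B⟩ else d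
  | 3 => recv.elim d fun m => ⟨d.start, m.length⟩
  | _ => d

end Device

/-- The memory of a device as a function of its history. -/
def memory (B : ℕ) : History → Device
  | [] => ⟨none, 0⟩
  | x :: h => (memory B h).update B (h.length / 4) h.head?.join x (h.length % 4)

/-- The protocol with `T` slots and duty length `B`. After the slots there is one more round, in
which the device on duty transmits, as the leader, and everybody else listens. -/
def queueAlgorithm (B T : ℕ) (part : ℕ → Fin N → Part) : Algorithm N where
  output _ h := if h.length ≤ 4 * T then none else
    some (if OnDuty B T (memory B h).start then .leader else .nonLeader)
  act v h := if h.length = 4 * T then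
      (if OnDuty B T (memory B h).start then .transmit [] else .listen)
    else (memory B h).act B (part (h.length / 4) v) (h.length / 4) h.head?.join (h.length % 4)

theorem Algorithm.length_history (A : Algorithm N) (S : Finset (Fin N)) (t : ℕ) (v : Fin N) :
    (A.history S t v).length = t := by
  induction t with
  | zero => rfl
  | succ t ih => simp [Algorithm.history, ih]

section run

variable (B T : ℕ) (part : ℕ → Fin N → Part) (S : Finset (Fin N))

/-- The memory of `v` before round `k` when the devices in `S` run the protocol. -/
noncomputable def memoryAt (k : ℕ) (v : Fin N) : Device :=
  memory B ((queueAlgorithm B T part).history S k v)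

/-- What `v` received in the round before round `k`. -/
noncomputable def lastAt (k : ℕ) (v : Fin N) : Option Msg :=
  ((queueAlgorithm B T part).history S k v).head?.join

theorem action_round {t r : ℕ} (ht : t < T) (hr : r < 4) (v : Fin N) :
    (queueAlgorithm B T part).action S (4 * t + r) v =
      (memoryAt B T part S (4 * t + r) v).act B (part t v) t
        (lastAt B T part S (4 * t + r) v) r := by
  have h1 : (4 * t + r) / 4 = t := by omega
  have h2 : (4 * t + r) % 4 = r := by omega
  have h3 : 4 * t + r ≤ 4 * T := by omega
  have h4 : 4 * t + r ≠ 4 * T := by omega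
  simp [Algorithm.action, Algorithm.step, queueAlgorithm, Algorithm.length_history, h1, h2, h3,
    h4, memoryAt, lastAt]

theorem action_last (v : Fin N) : (queueAlgorithm B T part).action S (4 * T) v =
        if OnDuty B T (memoryAt B T part S (4 * T) v).start then .transmit [] else .listen := by
  simp only [Algorithm.action, Algorithm.step, queueAlgorithm, Algorithm.length_history, memoryAt,
    le_refl, if_true]
  congr

theorem lastAt_succ (k : ℕ) (v : Fin N) : lastAt B T part S (k + 1) v =
    feedback (channel S ((queueAlgorithm B T part).action S k))
      ((queueAlgorithm B T part).action S k v) :=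
  rfl

theorem memoryAt_succ {t r : ℕ} (hr : r < 4) (v : Fin N) :
    memoryAt B T part S (4 * t + r + 1) v =
      (memoryAt B T part S (4 * t + r) v).update B t (lastAt B T part S (4 * t + r) v)
        (lastAt B T part S (4 * t + r + 1) v) r := by
  have h1 : (4 * t + r) / 4 = t := by omega
  have h2 : (4 * t + r) % 4 = r := by omega
  rw [memoryAt, Algorithm.history, memory, Algorithm.length_history, h1, h2]
  rfl

/-- The memories before slot `t` agree with the queue `σ`. Only the device on duty has to know the
tail of the queue. -/
def Agrees (t : ℕ) (σ : Queue N) : Prop :=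
  ∀ v ∈ S, (memoryAt B T part S (4 * t) v).start = σ.start v ∧
    (OnDuty B t (σ.start v) → (memoryAt B T part S (4 * t) v).tail = σ.tail)

variable {B T part S}

/-- The four rounds of a slot implement one step of the queue. -/
theorem Agrees.next {t : ℕ} {σ : Queue N} (hσ : σ.Valid B S t) (ht : t < T)
    (h : Agrees B T part S t σ) : Agrees B T part S (t + 1) (σ.next B S t (part t)) := by
  classical
  set A := queueAlgorithm B T part with hA
  -- The devices on duty: one if the queue is not exhausted, none otherwise
  set D := S.filter fun v => OnDuty B t (σ.start v) with hD
  have hDcard : D.card = 1 ↔ t < σ.tail := by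
    constructor
    · intro hc
      obtain ⟨u, hu⟩ := Finset.card_eq_one.1 hc
      have : u ∈ D := by simp [hu]
      obtain ⟨s, hs, hst, hts⟩ := (Finset.mem_filter.1 this).2
      have := hσ.le_tail u s hs
      omega
    · intro hlt
      obtain ⟨u, s, hs, hst, hts⟩ := hσ.cover t le_rfl hlt
      refine Finset.card_eq_one.2 ⟨u, Finset.eq_singleton_iff_unique_mem.2
        ⟨Finset.mem_filter.2 ⟨hσ.mem u s hs, s, hs, hst, hts⟩, fun v hv => ?_⟩⟩
      obtain ⟨s', hs', hst', hts'⟩ := (Finset.mem_filter.1 hv).2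
      by_contra hne
      have := hσ.disjoint v u s' s hs' hs hne
      omega
  have hDalive : ∀ v ∈ S, OnDuty B t (σ.start v) → t < σ.tail := by
    rintro v - ⟨s, hs, hst, hts⟩
    have := hσ.le_tail v s hs
    omega
  have hduty : ∀ v, OnDuty B t (σ.start v) → σ.start v ≠ none := by
    rintro v ⟨s, hs, -⟩
    simp [hs]
  set R := σ.fresh S (part t) .call with hR
  set R' := σ.fresh S (part t) .answer with hR'
  have memR : ∀ v, v ∈ R ↔ v ∈ S ∧ σ.start v = none ∧ part t v = .call := by
    simp [hR, Queue.fresh]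
  have memR' : ∀ v, v ∈ R' ↔ v ∈ S ∧ σ.start v = none ∧ part t v = .answer := by
    simp [hR', Queue.fresh]
  have memD : ∀ v, v ∈ D ↔ v ∈ S ∧ OnDuty B t (σ.start v) := by simp [hD]
  have hRsub : R ⊆ S := Finset.filter_subset _ _
  have hR'sub : R' ⊆ S := Finset.filter_subset _ _
  have hDsub : D ⊆ S := Finset.filter_subset _ _
  -- Round 0: the answerers learn whether somebody is on duty.
  have m1 : ∀ v, memoryAt B T part S (4 * t + 1) v = memoryAt B T part S (4 * t) v :=
    fun v => memoryAt_succ B T part S (r := 0) (by omega) v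
  have a0 : ∀ v ∈ S, A.action S (4 * t) v = if OnDuty B t (σ.start v) then .transmit [] else
      if σ.start v = none ∧ part t v = .answer then .listen else .idle := by
    intro v hv
    rw [← (h v hv).1]
    exact action_round B T part S (r := 0) ht (by omega) v
  have c0 : channel S (A.action S (4 * t)) = if t < σ.tail then some [] else none := by
    rw [channel_eq_ite (m := []) hDsub]
    · simp only [hDcard]
    · intro v hv
      rw [a0 v (hDsub hv), if_pos ((memD v).1 hv).2]
    · intro v hv m hm
      rw [a0 v hv] at hm
      split_ifs at hm with h1
      exact (memD v).2 ⟨hv, h1⟩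
  have p1 : ∀ v ∈ S, lastAt B T part S (4 * t + 1) v =
      if σ.start v = none ∧ part t v = .answer ∧ t < σ.tail then some [] else none := by
    intro v hv
    rw [lastAt_succ, c0, a0 v hv]
    have := hduty v
    by_cases h1 : OnDuty B t (σ.start v)
    · simp [h1, this h1, feedback]
    · by_cases h2 : σ.start v = none ∧ part t v = .answer
      · simp [h2, feedback]
      · simp only [h1, h2, if_false, feedback]
        rw [if_neg (by tauto)]
  -- Round 1: a call is received iff it is the only one.
  have m2 : ∀ v, memoryAt B T part S (4 * t + 2) v = memoryAt B T part S (4 * t) v := by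
    intro v
    rw [← m1]
    exact memoryAt_succ B T part S (r := 1) (by omega) v
  have a1 : ∀ v ∈ S, A.action S (4 * t + 1) v = if OnDuty B t (σ.start v) then .listen else
      if σ.start v = none ∧ part t v = .call then .transmit [] else
      if σ.start v = none ∧ part t v = .answer ∧ ¬ t < σ.tail then .listen else .idle := by
    intro v hv
    rw [action_round B T part S (r := 1) ht (by omega) v, Device.act, m1, (h v hv).1, p1 v hv]
    by_cases h2 : σ.start v = none ∧ part t v = .answer
    · simp [h2]
    · have e1 : ¬ (σ.start v = none ∧ part t v = .answer ∧ ¬ t < σ.tail) := by tauto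
      have e2 : ∀ P : Prop, ¬ (σ.start v = none ∧ part t v = .answer ∧ P) := by tauto
      rw [if_neg e1, if_neg (e2 _)]
  have c1 : channel S (A.action S (4 * t + 1)) = if R.card = 1 then some [] else none := by
    refine channel_eq_ite (m := []) hRsub ?_ ?_
    · intro v hv
      have hv' := (memR v).1 hv
      rw [a1 v hv'.1, if_neg fun hd => hduty v hd hv'.2.1, if_pos hv'.2]
    · intro v hv m hm
      rw [a1 v hv] at hm
      split_ifs at hm with h1 h2
      exact (memR v).2 ⟨hv, h2⟩
  have p2 : ∀ v ∈ S, lastAt B T part S (4 * t + 2) v =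
      if (OnDuty B t (σ.start v) ∨ σ.start v = none ∧ part t v = .answer ∧ ¬ t < σ.tail) ∧
        R.card = 1 then some [] else none := by
    intro v hv
    rw [lastAt_succ, c1, a1 v hv]
    by_cases h1 : OnDuty B t (σ.start v)
    · simp [h1, feedback]
    · by_cases h2 : σ.start v = none ∧ part t v = .call
      · simp [h2, feedback]
      · by_cases h3 : σ.start v = none ∧ part t v = .answer ∧ ¬ t < σ.tail
        · rw [if_neg h1, if_neg h2, if_pos h3]
          simp only [h3, feedback]
          simp
        · simp only [h1, h2, h3, if_false, feedback]
          simp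
  -- Round 2: a call is confirmed iff its sender joins; two answerers would collide.
  have a2 : ∀ v ∈ S, A.action S (4 * t + 2) v =
      if OnDuty B t (σ.start v) then (if R.card = 1 then .transmit (numMsg σ.tail) else .idle) else
      if σ.start v = none ∧ part t v = .call then .listen else
      if (σ.start v = none ∧ part t v = .answer ∧ ¬ t < σ.tail) ∧ R.card = 1 then
        .transmit (numMsg (t + 1)) else .idle := by
    intro v hv
    rw [action_round B T part S (r := 2) ht (by omega) v, Device.act, m2, (h v hv).1, p2 v hv]
    by_cases h1 : OnDuty B t (σ.start v)
    · rw [if_pos h1, if_pos h1, (h v hv).2 h1]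
      by_cases hc : R.card = 1 <;> simp [h1, hc]
    · rw [if_neg h1, if_neg h1]
      by_cases h2 : σ.start v = none ∧ part t v = .call
      · rw [if_pos h2, if_pos h2]
      · rw [if_neg h2, if_neg h2]
        refine if_congr ?_ rfl rfl
        by_cases hc : R.card = 1
        · simp only [h1, hc, and_true, false_or]
          by_cases h3 : σ.start v = none ∧ part t v = .answer ∧ ¬ t < σ.tail
          · simp [h3]
          · simp only [h3, if_false]
            simp
        · simp [hc]
  have c2 : channel S (A.action S (4 * t + 2)) =
      if σ.Joins S t (part t) then some (numMsg (max σ.tail (t + 1))) else none := by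
    by_cases hc : R.card = 1
    swap
    · rw [if_neg fun hj => hc hj.1]
      refine channel_eq_none fun ⟨u, ⟨hu, m, hm⟩, _⟩ => ?_
      rw [a2 u hu] at hm
      simp only [hc, and_false, if_false] at hm
      split_ifs at hm
    · by_cases halive : t < σ.tail
      · have hmax : max σ.tail (t + 1) = σ.tail := by omega
        have hj : σ.Joins S t (part t) := ⟨hc, Or.inl halive⟩
        rw [if_pos hj, hmax, channel_eq_ite (m := numMsg σ.tail) hDsub, if_pos (hDcard.2 halive)]
        · intro v hv
          rw [a2 v (hDsub hv), if_pos ((memD v).1 hv).2, if_pos hc]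
        · intro v hv m hm
          rw [a2 v hv] at hm
          simp only [halive, not_true, and_false, false_and, if_false] at hm
          split_ifs at hm with h1
          exact (memD v).2 ⟨hv, h1⟩
      · have hmax : max σ.tail (t + 1) = t + 1 := by omega
        have hj : σ.Joins S t (part t) ↔ R'.card = 1 := by
          simp only [Queue.Joins, halive, false_or]
          exact ⟨fun hh => hh.2, fun hh => ⟨hc, hh⟩⟩
        rw [hmax, channel_eq_ite (m := numMsg (t + 1)) hR'sub]
        · simp only [hj]
        · intro v hv
          have hv' := (memR' v).1 hv
          rw [a2 v hv'.1, if_neg fun hd => hduty v hd hv'.2.1, if_neg (by simp [hv'.2]),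
            if_pos ⟨⟨hv'.2.1, hv'.2.2, halive⟩, hc⟩]
        · intro v hv m hm
          rw [a2 v hv] at hm
          split_ifs at hm with h1 h2 h4
          · exact absurd (hDalive v hv h1) halive
          · exact (memR' v).2 ⟨hv, h4.1.1, h4.1.2.1⟩
  have p3 : ∀ v ∈ S, lastAt B T part S (4 * t + 3) v =
      if v ∈ R ∧ σ.Joins S t (part t) then some (numMsg (max σ.tail (t + 1))) else none := by
    intro v hv
    rw [lastAt_succ, c2, a2 v hv]
    by_cases h2 : v ∈ R
    · have hv' := (memR v).1 h2
      rw [if_neg fun hd => hduty v hd hv'.2.1, if_pos hv'.2]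
      simp [h2, feedback]
    · have h3 : ¬ (σ.start v = none ∧ part t v = .call) := fun h3 => h2 ((memR v).2 ⟨hv, h3⟩)
      have h4 : ¬ (v ∈ R ∧ σ.Joins S t (part t)) := fun h4 => h2 h4.1
      rw [if_neg h3, if_neg h4]
      split_ifs <;> rfl
  have m3 : ∀ v ∈ S, (memoryAt B T part S (4 * t + 3) v).start =
        (σ.next B S t (part t)).start v ∧
      (OnDuty B t (σ.start v) → (memoryAt B T part S (4 * t + 3) v).tail =
        (σ.next B S t (part t)).tail) ∧
      (v ∈ R → σ.Joins S t (part t) → (memoryAt B T part S (4 * t + 3) v).tail =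
        (σ.next B S t (part t)).tail) := by
    intro v hv
    rw [memoryAt_succ B T part S (r := 2) (by omega) v, Device.update, m2, (h v hv).1, p2 v hv,
      p3 v hv]
    by_cases hn : σ.start v = none
    · have h1 : ¬ OnDuty B t (σ.start v) := fun hd => hduty v hd hn
      by_cases hj : σ.Joins S t (part t)
      · by_cases hvR : v ∈ R
        · simp [hn, hj, hvR, Queue.next, ← hR, OnDuty]
        · simp [hn, hj, hvR, Queue.next, ← hR, OnDuty, (h v hv).1]
      · simp [hn, hj, Queue.next, OnDuty, (h v hv).1]
    · have hvR : v ∉ R := fun hvR => hn ((memR v).1 hvR).2.1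
      by_cases h1 : OnDuty B t (σ.start v)
      · have halive := hDalive v hv h1
        have hj : σ.Joins S t (part t) ↔ R.card = 1 := by
          simp only [Queue.Joins, halive, true_or, and_true]
          rfl
        have hmax : max σ.tail (t + 1) = σ.tail := by omega
        by_cases hc : R.card = 1
        · simp [hn, h1, hc, hj, hvR, Queue.next, ← hR, (h v hv).2 h1, hmax]
        · simp [hn, h1, hc, hj, hvR, Queue.next, (h v hv).2 h1, (h v hv).1]
      · have hs : (σ.next B S t (part t)).start v = σ.start v := by
          by_cases hj : σ.Joins S t (part t) <;> simp [Queue.next, hj, ← hR, hvR]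
        simp [hn, h1, hvR, hs, (h v hv).1]
  -- Round 3: the successor, if any, learns the new tail.
  set σ' := σ.next B S t (part t) with hσ'
  have hstart : ∀ v, OnDuty B t (σ'.start v) ↔ OnDuty B t (σ.start v) := by
    intro v
    by_cases hj : σ.Joins S t (part t)
    · by_cases hvR : v ∈ R
      · have hn := ((memR v).1 hvR).2.1
        have hs : σ'.start v = some (max σ.tail (t + 1)) := by
          simp [hσ', Queue.next, hj, ← hR, hvR]
        rw [hs, hn]
        simp only [OnDuty, Option.some.injEq]
        constructor
        · rintro ⟨s, rfl, hs, -⟩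
          omega
        · rintro ⟨s, hs, -⟩
          cases hs
      · have hs : σ'.start v = σ.start v := by simp [hσ', Queue.next, hj, ← hR, hvR]
        rw [hs]
    · have hs : σ' = σ := by simp [hσ', Queue.next, hj]
      rw [hs]
  have a3 : ∀ v ∈ S, A.action S (4 * t + 3) v =
      if OnDuty B t (σ.start v) then .transmit (numMsg σ'.tail) else
      if σ'.start v = some (t + 1) then .listen else .idle := by
    intro v hv
    rw [action_round B T part S (r := 3) ht (by omega) v, Device.act, (m3 v hv).1]
    · simp only [hstart]
      split_ifs with h1
      · rw [(m3 v hv).2.1 h1]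
      all_goals rfl
    all_goals simp
  have c3 : channel S (A.action S (4 * t + 3)) =
      if t < σ.tail then some (numMsg σ'.tail) else none := by
    rw [channel_eq_ite (m := numMsg σ'.tail) hDsub]
    · simp only [hDcard]
    · intro v hv
      rw [a3 v (hDsub hv), if_pos ((memD v).1 hv).2]
    · intro v hv m hm
      rw [a3 v hv] at hm
      split_ifs at hm with h1
      exact (memD v).2 ⟨hv, h1⟩
  have p4 : ∀ v ∈ S, lastAt B T part S (4 * t + 4) v =
      if σ'.start v = some (t + 1) ∧ t < σ.tail then some (numMsg σ'.tail) else none := by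
    intro v hv
    rw [lastAt_succ, c3, a3 v hv]
    by_cases h1 : OnDuty B t (σ.start v)
    · have h2 : σ'.start v ≠ some (t + 1) := by
        intro h2
        obtain ⟨s, hs, hst, -⟩ := (hstart v).2 h1
        rw [h2, Option.some.injEq] at hs
        omega
      simp [h1, h2, feedback]
    · by_cases h2 : σ'.start v = some (t + 1) <;> simp [h1, h2, feedback]
  intro v hv
  have e : 4 * (t + 1) = 4 * t + 3 + 1 := by ring
  rw [e, memoryAt_succ B T part S (r := 3) (by omega) v, Device.update, p4 v hv]
  by_cases h2 : σ'.start v = some (t + 1) ∧ t < σ.tail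
  · rw [if_pos h2]
    simp [(m3 v hv).1]
  · rw [if_neg h2]
    refine ⟨(m3 v hv).1, fun hd => ?_⟩
    obtain ⟨s, hs, hst, hts⟩ := hd
    by_cases hs1 : s = t + 1
    · -- Nobody was on duty in slot `t`, so `v` joined in this slot
      have hna : ¬ t < σ.tail := fun ha => h2 ⟨hs1 ▸ hs, ha⟩
      by_cases hvR : v ∈ R ∧ σ.Joins S t (part t)
      · exact (m3 v hv).2.2 hvR.1 hvR.2
      · have hs' : σ.start v = some s := by
          rw [← hs, hσ', Queue.next]
          split_ifs with hj
          · exact (if_neg fun hvR' => hvR ⟨hvR', hj⟩).symm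
          · rfl
        have := hσ.le_tail v s hs'
        omega
    · exact (m3 v hv).2.1 ((hstart v).1 ⟨s, hs, by omega, by omega⟩)

theorem agrees_run {t : ℕ} (ht : t ≤ T) :
    Agrees B T part S t (Queue.run B S part t) := by
  induction t with
  | zero =>
    intro v hv
    exact ⟨rfl, fun ⟨s, hs, _⟩ => by cases hs⟩
  | succ t ih => exact (ih (by omega)).next (Queue.valid_run B S part t) (by omega)

end run

/-! ### Correctness and energy -/

section correctness

variable {B T : ℕ} {part : ℕ → Fin N → Part} {S : Finset (Fin N)}

/-- The protocol elects a leader as soon as the duties assigned extend beyond the last slot. -/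
theorem electsLeader (h : T < (Queue.run B S part T).tail) :
    (queueAlgorithm B T part).ElectsLeader S (4 * T + 1) := by
  have hval := Queue.valid_run B S part T
  have hag := agrees_run (B := B) (part := part) (S := S) (le_refl T)
  have hstart : ∀ v ∈ S, (memoryAt B T part S (4 * T + 1) v).start =
      (Queue.run B S part T).start v := fun v hv => by
    rw [← (hag v hv).1]
    exact congrArg _ (memoryAt_succ B T part S (r := 0) (by omega) v)
  have hout : ∀ v ∈ S, (queueAlgorithm B T part).output v
      ((queueAlgorithm B T part).history S (4 * T + 1) v) =
        some (if OnDuty B T ((Queue.run B S part T).start v) then .leader else .nonLeader) := by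
    intro v hv
    rw [← hstart v hv]
    refine (if_neg ?_).trans rfl
    rw [Algorithm.length_history]
    omega
  have hact : ∀ v ∈ S, (queueAlgorithm B T part).action S (4 * T) v =
      if OnDuty B T ((Queue.run B S part T).start v) then .transmit [] else .listen := by
    intro v hv
    rw [action_last, (hag v hv).1]
  refine ⟨by omega, fun t ht v _ => if_pos ?_, ?_⟩
  · rw [Algorithm.length_history]
    omega
  obtain ⟨l, s, hs, hsT, hTs⟩ := hval.cover T le_rfl h
  have hl : OnDuty B T ((Queue.run B S part T).start l) := ⟨s, hs, hsT, hTs⟩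
  have hlS := hval.mem l s hs
  refine ⟨l, hlS, ?_, ⟨[], ?_⟩, fun v hv hvl => ?_⟩
  · rw [hout l hlS, if_pos hl]
  · exact (hact l hlS).trans (if_pos hl)
  · have hnot : ¬ OnDuty B T ((Queue.run B S part T).start v) := by
      rintro ⟨s', hs', hsT', hTs'⟩
      have := hval.disjoint v l s' s hs' hs hvl
      omega
    exact ⟨by rw [hout v hv, if_neg hnot], (hact v hv).trans (if_neg hnot)⟩

theorem Device.start_update (B t r : ℕ) (d : Device) (last recv : Option Msg) {s : ℕ}
    (h : d.start = some s) : (d.update B t last recv r).start = some s := by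
  unfold Device.update
  split
  · rw [if_neg (by simp [h])]
    split_ifs <;> exact h
  · cases recv <;> exact h
  · exact h

/-- A device that has joined keeps its duty interval. -/
theorem start_memoryAt_mono {k k' : ℕ} (hk : k ≤ k') {v : Fin N} {s : ℕ}
    (h : (memoryAt B T part S k v).start = some s) :
    (memoryAt B T part S k' v).start = some s := by
  induction k', hk using Nat.le_induction with
  | base => exact h
  | succ k' _ ih => exact Device.start_update _ _ _ _ _ _ ih

/-- A device that is not idle in slot `t` has an active part, or it is on duty in slot `t`, or its
duty starts in slot `t + 1`; the latter two are covered by a single condition on `t + 1`. -/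
theorem Device.cases_of_act_ne_idle {B t r : ℕ} {p : Part} {d : Device} {last : Option Msg}
    (h : d.act B p t last r ≠ .idle) :
    p ≠ .sleep ∨ ∃ s, d.start = some s ∧ t + 1 ∈ Finset.Icc s (s + B) := by
  by_cases hd : OnDuty B t d.start
  · obtain ⟨s, hs, h1, h2⟩ := hd
    exact Or.inr ⟨s, hs, Finset.mem_Icc.2 (by omega)⟩
  by_cases hs : d.start = some (t + 1)
  · exact Or.inr ⟨t + 1, hs, Finset.mem_Icc.2 (by omega)⟩
  refine Or.inl fun hp => h ?_
  unfold Device.act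
  split <;> simp [hd, hp, hs]

/-- A device is awake in the slots in which its part is not to sleep, in its duty slots, in the
slot before its duty, and in the very last round. -/
theorem energy_le (v : Fin N) : (queueAlgorithm B T part).energy S (4 * T + 1) v ≤
    4 * (((Finset.range T).filter fun t => part t v ≠ .sleep).card + (B + 1)) + 1 := by
  set X := (Finset.range T).filter fun t => part t v ≠ .sleep
  set o := (memoryAt B T part S (4 * T) v).start with ho
  set Y : Finset ℕ := (Finset.range T).filter fun t =>
    ∃ s, o = some s ∧ t + 1 ∈ Finset.Icc s (s + B)
  have hY : Y.card ≤ B + 1 := by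
    by_cases h : ∃ s, o = some s
    · obtain ⟨s, hs⟩ := h
      calc Y.card = (Y.image (· + 1)).card :=
            (Finset.card_image_of_injective _ (add_left_injective 1)).symm
        _ ≤ (Finset.Icc s (s + B)).card := by
            refine Finset.card_le_card fun x hx => ?_
            obtain ⟨t, ht, rfl⟩ := Finset.mem_image.1 hx
            obtain ⟨s', hs', h⟩ := (Finset.mem_filter.1 ht).2
            rw [hs, Option.some.injEq] at hs'
            exact hs' ▸ h
        _ = B + 1 := by simp; omega
    · have : Y = ∅ := Finset.filter_eq_empty_iff.2 fun t _ ⟨s, hs, _⟩ => h ⟨s, hs⟩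
      simp [this]
  have hsub : ((Finset.range (4 * T + 1)).filter
      fun k => (queueAlgorithm B T part).action S k v ≠ .idle) ⊆
      insert (4 * T) ((X ∪ Y).biUnion fun t => Finset.Ico (4 * t) (4 * t + 4)) := by
    intro k hk
    obtain ⟨hk, hka⟩ := Finset.mem_filter.1 hk
    rw [Finset.mem_range] at hk
    rw [Finset.mem_insert]
    by_cases hkT : k = 4 * T
    · exact Or.inl hkT
    refine Or.inr (Finset.mem_biUnion.2 ⟨k / 4, ?_, Finset.mem_Ico.2 (by omega)⟩)
    have hT : k / 4 < T := by omega
    have e : k = 4 * (k / 4) + k % 4 := by omega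
    rw [e, action_round B T part S hT (by omega)] at hka
    rw [Finset.mem_union]
    rcases Device.cases_of_act_ne_idle hka with h | ⟨s, hs, h⟩
    · exact Or.inl (Finset.mem_filter.2 ⟨Finset.mem_range.2 hT, h⟩)
    · exact Or.inr (Finset.mem_filter.2 ⟨Finset.mem_range.2 hT, s,
        start_memoryAt_mono (by omega) hs, h⟩)
  calc _ ≤ _ := Finset.card_le_card hsub
    _ ≤ ((X ∪ Y).biUnion fun t => Finset.Ico (4 * t) (4 * t + 4)).card + 1 :=
        Finset.card_insert_le _ _
    _ ≤ (X ∪ Y).card * 4 + 1 := by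
        gcongr
        exact Finset.card_biUnion_le_card_mul _ _ _ fun t _ => by simp
    _ ≤ 4 * (X.card + (B + 1)) + 1 := by
        have := Finset.card_union_le X Y
        omega

end correctness

/-! ### Random rows of parts -/

/-- The part encoded by a letter of an alphabet of size `k`: two letters stand for the active parts,
all the others for sleeping. -/
def partOf {k : ℕ} (x : Fin k) : Part :=
  if x.val = 0 then .call else if x.val = 1 then .answer else .sleep

theorem partOf_eq_call {k : ℕ} {x : Fin k} : partOf x = .call ↔ x.val = 0 := by
  unfold partOf
  split_ifs <;> simp_all

theorem partOf_eq_answer {k : ℕ} {x : Fin k} : partOf x = .answer ↔ x.val = 1 := by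
  unfold partOf
  split_ifs <;> simp_all

theorem partOf_eq_sleep {k : ℕ} {x : Fin k} : partOf x = .sleep ↔ 2 ≤ x.val := by
  unfold partOf
  split_ifs <;> simp_all
  omega

theorem card_partOf_call {k : ℕ} (hk : 2 ≤ k) :
    (Finset.univ.filter fun x : Fin k => partOf x = .call).card = 1 :=
  Finset.card_eq_one.2 ⟨⟨0, by omega⟩, by
    ext x
    simp [partOf_eq_call, Fin.ext_iff]⟩

theorem card_partOf_answer {k : ℕ} (hk : 2 ≤ k) :
    (Finset.univ.filter fun x : Fin k => partOf x = .answer).card = 1 :=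
  Finset.card_eq_one.2 ⟨⟨1, by omega⟩, by
    ext x
    simp [partOf_eq_answer, Fin.ext_iff]⟩

theorem card_partOf_sleep {k : ℕ} (hk : 2 ≤ k) :
    (Finset.univ.filter fun x : Fin k => partOf x = .sleep).card = k - 2 := by
  have h : (Finset.univ.filter fun x : Fin k => partOf x = .sleep) =
      Finset.univ \ {⟨0, by omega⟩, ⟨1, by omega⟩} := by
    ext x
    simp only [partOf_eq_sleep, Finset.mem_filter, Finset.mem_univ, true_and, Finset.mem_sdiff,
      Finset.mem_insert, Finset.mem_singleton, Fin.ext_iff]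
    omega
  rw [h, Finset.card_sdiff_of_subset (Finset.subset_univ _)]
  simp

/-- A row of parts isolates a pair in `F` if exactly one member of `F` calls and exactly one
answers. -/
def Isolates {k : ℕ} (F : Finset (Fin N)) (r : Fin N → Fin k) : Prop :=
  (F.filter fun v => partOf (r v) = .call).card = 1 ∧
    (F.filter fun v => partOf (r v) = .answer).card = 1

instance {k : ℕ} (F : Finset (Fin N)) (r : Fin N → Fin k) : Decidable (Isolates F r) :=
  inferInstanceAs (Decidable (_ ∧ _))

/-- The letters allowed at `v` if, within `F`, only `u` calls and only `w` answers. -/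
def pairLetters (k : ℕ) (F : Finset (Fin N)) (u w v : Fin N) : Finset (Fin k) :=
  if v = u then Finset.univ.filter fun x => partOf x = .call
  else if v = w then Finset.univ.filter fun x => partOf x = .answer
  else if v ∈ F then Finset.univ.filter fun x => partOf x = .sleep
  else Finset.univ

theorem card_piFinset_pairLetters {k : ℕ} (hk : 2 ≤ k) {F : Finset (Fin N)} {u w : Fin N}
    (hu : u ∈ F) (hw : w ∈ F) (huw : u ≠ w) :
    ((Fintype.piFinset (pairLetters k F u w)).card : ℝ) =
      (k : ℝ) ^ N * ((1 / k) ^ 2 * (1 - 2 / k) ^ (F.card - 2)) := by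
  have hk0 : (k : ℝ) ≠ 0 := by positivity
  let θ : Fin N → ℝ := fun v => if v = u then 1 / k else if v = w then 1 / k else
    if v ∈ F then 1 - 2 / k else 1
  have hθ : ∀ v, ((pairLetters k F u w v).card : ℝ) = k * θ v := by
    intro v
    simp only [pairLetters, θ]
    split_ifs
    · rw [card_partOf_call hk]
      field_simp
      simp
    · rw [card_partOf_answer hk]
      field_simp
      simp
    · rw [card_partOf_sleep hk, Nat.cast_sub hk]
      field_simp
      simp
    · simp
  have huw' : w ∈ F.erase u := Finset.mem_erase.2 ⟨huw.symm, hw⟩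
  have hprod : ∏ v, θ v = (1 / k) ^ 2 * (1 - 2 / k : ℝ) ^ (F.card - 2) := by
    rw [← Finset.prod_subset (Finset.subset_univ F) (fun v _ hv => by
      have h1 : v ≠ u := fun h => hv (h ▸ hu)
      have h2 : v ≠ w := fun h => hv (h ▸ hw)
      simp [θ, h1, h2, hv]), ← Finset.mul_prod_erase _ _ hu, ← Finset.mul_prod_erase _ _ huw',
      Finset.prod_congr rfl (g := fun _ => (1 - 2 / k : ℝ)), Finset.prod_const,
      Finset.card_erase_of_mem huw', Finset.card_erase_of_mem hu]
    · simp only [θ, if_true, if_neg huw.symm]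
      rw [Nat.sub_sub]
      ring
    · intro v hv
      simp only [Finset.mem_erase] at hv
      simp [θ, hv.1, hv.2.1, hv.2.2]
  rw [Fintype.card_piFinset, Nat.cast_prod, Finset.prod_congr rfl fun v _ => hθ v,
    Finset.prod_mul_distrib, hprod]
  simp

theorem mem_piFinset_pairLetters {k : ℕ} {F : Finset (Fin N)} {u w : Fin N} (huw : u ≠ w)
    {r : Fin N → Fin k} (hr : r ∈ Fintype.piFinset (pairLetters k F u w)) :
    partOf (r u) = .call ∧ partOf (r w) = .answer ∧
      ∀ v ∈ F, v ≠ u → v ≠ w → partOf (r v) = .sleep := by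
  rw [Fintype.mem_piFinset] at hr
  refine ⟨?_, ?_, fun v hv h1 h2 => ?_⟩
  · simpa [pairLetters] using hr u
  · simpa [pairLetters, huw.symm] using hr w
  · simpa [pairLetters, hv, h1, h2] using hr v

/-- A uniformly random row isolates a pair in `F` with constant probability if the size of the
alphabet is comparable to that of `F`. -/
theorem card_isolates {q : ℕ} (F : Finset (Fin N)) (h2 : 2 ≤ F.card) (hq : F.card ≤ q)
    (hF : q ≤ 8 * F.card) :
    ((4 * q : ℕ) : ℝ) ^ N / 4096 ≤
      (Finset.univ.filter fun r : Fin N → Fin (4 * q) => Isolates F r).card := by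
  set k := 4 * q with hk
  have hk2 : 2 ≤ k := by omega
  set E : Fin N × Fin N → Finset (Fin N → Fin k) :=
    fun p => Fintype.piFinset (pairLetters k F p.1 p.2) with hE
  have hdisj : (F.offDiag : Set (Fin N × Fin N)).PairwiseDisjoint E := by
    rintro ⟨u, w⟩ hp ⟨u', w'⟩ hp' hne
    simp only [Finset.coe_offDiag, Set.mem_offDiag, Finset.mem_coe] at hp hp'
    refine Finset.disjoint_left.2 fun r hr hr' => hne ?_
    obtain ⟨c1, c2, c3⟩ := mem_piFinset_pairLetters hp.2.2 hr
    obtain ⟨d1, d2, d3⟩ := mem_piFinset_pairLetters hp'.2.2 hr'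
    have e1 : u' = u := by
      by_contra h
      by_cases h' : u' = w
      · rw [h', c2] at d1
        cases d1
      · rw [c3 u' hp'.1 h h'] at d1
        cases d1
    have e2 : w' = w := by
      by_contra h
      by_cases h' : w' = u
      · rw [h', c1] at d2
        cases d2
      · rw [c3 w' hp'.2.1 h' h] at d2
        cases d2
    rw [e1, e2]
  have hsub : F.offDiag.biUnion E ⊆
      Finset.univ.filter fun r : Fin N → Fin k => Isolates F r := by
    intro r hr
    obtain ⟨⟨u, w⟩, hp, hr⟩ := Finset.mem_biUnion.1 hr
    rw [Finset.mem_offDiag] at hp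
    obtain ⟨c1, c2, c3⟩ := mem_piFinset_pairLetters hp.2.2 hr
    refine Finset.mem_filter.2 ⟨Finset.mem_univ _, Finset.card_eq_one.2 ⟨u, ?_⟩,
      Finset.card_eq_one.2 ⟨w, ?_⟩⟩
    · ext v
      simp only [Finset.mem_filter, Finset.mem_singleton]
      refine ⟨fun ⟨hv, hc⟩ => ?_, fun h => h ▸ ⟨hp.1, c1⟩⟩
      by_contra h
      by_cases h' : v = w
      · rw [h', c2] at hc
        cases hc
      · rw [c3 v hv h h'] at hc
        cases hc
    · ext v
      simp only [Finset.mem_filter, Finset.mem_singleton]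
      refine ⟨fun ⟨hv, hc⟩ => ?_, fun h => h ▸ ⟨hp.2.1, c2⟩⟩
      by_contra h
      by_cases h' : v = u
      · rw [h', c1] at hc
        cases hc
      · rw [c3 v hv h' h] at hc
        cases hc
  have hcard : ((F.offDiag.biUnion E).card : ℝ) =
      (F.card * F.card - F.card : ℕ) * ((k : ℝ) ^ N *
        ((1 / k) ^ 2 * (1 - 2 / k) ^ (F.card - 2))) := by
    have hE' : ∀ p ∈ F.offDiag, ((E p).card : ℝ) =
        (k : ℝ) ^ N * ((1 / k) ^ 2 * (1 - 2 / k) ^ (F.card - 2)) := fun p hp => by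
      rw [Finset.mem_offDiag] at hp
      exact card_piFinset_pairLetters hk2 hp.1 hp.2.1 hp.2.2
    rw [Finset.card_biUnion hdisj, Nat.cast_sum, Finset.sum_congr rfl hE', Finset.sum_const,
      Finset.offDiag_card, nsmul_eq_mul]
  refine le_trans ?_ ((hcard.symm.le).trans (by exact_mod_cast Finset.card_le_card hsub))
  have hq0 : (0 : ℝ) < q := by
    have : 0 < q := by omega
    exact_mod_cast this
  have hs2 : (2 : ℝ) ≤ F.card := by exact_mod_cast h2
  have hsq : (F.card : ℝ) ≤ q := by exact_mod_cast hq
  have hqs : (q : ℝ) ≤ 8 * F.card := by exact_mod_cast hF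
  have hkq : (k : ℝ) = 4 * q := by
    rw [hk]
    push_cast
    ring
  have hpow : (1 / 2 : ℝ) ≤ (1 - 2 / k) ^ (F.card - 2) := by
    have hb := one_add_mul_le_pow (a := -(2 / k : ℝ)) (by
      rw [hkq]
      have : 2 / (4 * q : ℝ) ≤ 1 := by
        rw [div_le_one (by positivity)]
        linarith
      linarith) (F.card - 2)
    rw [← sub_eq_add_neg] at hb
    refine le_trans ?_ hb
    rw [Nat.cast_sub h2, hkq]
    have : ((F.card : ℝ) - 2) * (2 / (4 * q)) ≤ 1 / 2 := by
      rw [mul_div_assoc', div_le_div_iff₀ (by positivity) (by norm_num)]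
      linarith
    push_cast
    linarith
  have hpairs : ((F.card * F.card - F.card : ℕ) : ℝ) = F.card * F.card - F.card := by
    rw [Nat.cast_sub (Nat.le_mul_self _)]
    push_cast
    ring
  rw [hpairs]
  have hmain : (1 / 4096 : ℝ) ≤ ((F.card : ℝ) * F.card - F.card) * ((1 / k) ^ 2 * (1 / 2)) := by
    rw [hkq]
    have : ((F.card : ℝ) * F.card - F.card) * ((1 / (4 * q)) ^ 2 * (1 / 2)) =
        ((F.card : ℝ) * F.card - F.card) / (32 * q ^ 2) := by
      field_simp
      ring
    rw [this, div_le_div_iff₀ (by norm_num) (by positivity)]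
    nlinarith
  calc (k : ℝ) ^ N / 4096 = (k : ℝ) ^ N * (1 / 4096) := by ring
    _ ≤ (k : ℝ) ^ N * (((F.card : ℝ) * F.card - F.card) * ((1 / k) ^ 2 *
          (1 - 2 / k) ^ (F.card - 2))) := by
        gcongr
        refine hmain.trans ?_
        have : (0 : ℝ) ≤ (F.card : ℝ) * F.card - F.card := by nlinarith
        gcongr
    _ = _ := by ring

/-- Under a uniformly random row, a device is active with probability `2 / k`. -/
theorem sum_row_weight {k : ℕ} (hk : 2 ≤ k) (v : Fin N) :
    ∑ r : Fin N → Fin k, (if partOf (r v) = .sleep then (1 : ℝ) else 2) =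
      (k : ℝ) ^ N * (1 + 2 / k) := by
  have hk0 : (k : ℝ) ≠ 0 := by positivity
  have hletters : ∑ x : Fin k, (if partOf x = .sleep then (1 : ℝ) else 2) = k + 2 := by
    have : ∀ x : Fin k, (if partOf x = .sleep then (1 : ℝ) else 2) =
        2 - if partOf x = .sleep then 1 else 0 := by
      intro x
      split_ifs <;> norm_num
    rw [Finset.sum_congr rfl fun x _ => this x, Finset.sum_sub_distrib, Finset.sum_boole,
      card_partOf_sleep hk, Nat.cast_sub hk]
    simp
    ring
  have h := Finset.prod_univ_sum (fun _ : Fin N => (Finset.univ : Finset (Fin k)))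
    (fun v' x => if v' = v then (if partOf x = .sleep then (1 : ℝ) else 2) else 1)
  rw [Fintype.piFinset_univ] at h
  simp only [Finset.prod_ite_eq', Finset.mem_univ, if_true] at h
  rw [← h]
  have h' : ∀ v', ∑ x : Fin k, (if v' = v then (if partOf x = .sleep then (1 : ℝ) else 2) else 1) =
      (k : ℝ) * if v' = v then (1 + 2 / k : ℝ) else 1 := by
    intro v'
    split_ifs
    · rw [hletters]
      field_simp
    · simp
  rw [Finset.prod_congr rfl fun v' _ => h' v', Finset.prod_mul_distrib]
  simp

/-! ### Derandomization -/

/-- The method of conditional expectations: if the average of the potential `W` over the next choice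
never increases, then some sequence of choices keeps it below its initial value. -/
theorem exists_choices_of_sum_le {R σ : Type*} [Fintype R] [Nonempty R] (f : ℕ → σ → R → σ)
    (W : ℕ → σ → ℝ) (h : ∀ t s, ∑ r, W (t + 1) (f t s r) ≤ Fintype.card R * W t s) (s₀ : σ) :
    ∃ (r : ℕ → R) (s : ℕ → σ), s 0 = s₀ ∧ (∀ t, s (t + 1) = f t (s t) (r t)) ∧
      ∀ t, W t (s t) ≤ W 0 s₀ := by
  have hstep : ∀ t s, ∃ r, W (t + 1) (f t s r) ≤ W t s := by
    intro t s
    obtain ⟨r, -, hr⟩ := Finset.exists_le_of_sum_le (s := (Finset.univ : Finset R))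
      (f := fun r => W (t + 1) (f t s r)) (g := fun _ => W t s) Finset.univ_nonempty
      (by simpa using h t s)
    exact ⟨r, hr⟩
  choose g hg using hstep
  let s : ℕ → σ := fun t => Nat.rec s₀ (fun t s => f t s (g t s)) t
  refine ⟨fun t => g t (s t), s, rfl, fun t => rfl, fun t => ?_⟩
  induction t with
  | zero => exact le_rfl
  | succ t ih => exact (hg t (s t)).trans ih

/-- The potential of a queue: it halves whenever a device joins, and vanishes once `g` devices have
joined. -/
noncomputable def Queue.potential (g : ℕ) (σ : Queue N) : ℝ :=
  if σ.joined.card < g then (1 / 2) ^ σ.joined.card else 0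

theorem Queue.potential_nonneg (g : ℕ) (σ : Queue N) : 0 ≤ σ.potential g := by
  unfold potential
  split_ifs <;> positivity

/-- Isolating a pair of fresh devices suffices for a join, no matter whether somebody is on duty. -/
theorem Queue.joins_of_isolates {k : ℕ} {σ : Queue N} {P : Finset (Fin N)} (t : ℕ)
    {r : Fin N → Fin k} (h : Isolates (P.filter fun v => σ.start v = none) r) :
    σ.Joins P t fun v => partOf (r v) := by
  rw [Isolates, Finset.filter_filter, Finset.filter_filter] at h
  exact ⟨h.1, Or.inr h.2⟩

theorem Queue.potential_next_le {g : ℕ} (B t : ℕ) (P : Finset (Fin N)) (part : Fin N → Part)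
    (σ : Queue N) : (σ.next B P t part).potential g ≤
      σ.potential g - if σ.Joins P t part then σ.potential g / 2 else 0 := by
  have hcard := card_joined_next B P t part σ
  unfold potential
  rw [hcard]
  have hpos : (0 : ℝ) ≤ (1 / 2) ^ σ.joined.card := by positivity
  by_cases h : σ.Joins P t part
  · simp only [if_pos h]
    split_ifs with h1 h2 h2
    · rw [pow_succ]
      linarith
    · omega
    · linarith
    · simp
  · simp [if_neg h]

/-- Under a uniformly random row, the expected potential drops by a constant factor: as long as at most
`q / 16` devices have joined, at least `q / 8` are fresh. -/
theorem Queue.sum_potential_next_le {q : ℕ} (B t : ℕ) (σ : Queue N) {P : Finset (Fin N)}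
    (h2 : 2 ≤ P.card) (hq : P.card ≤ q) (h4 : q < 4 * P.card) :
    ∑ r : Fin N → Fin (4 * q),
        (σ.next B P t fun v => partOf (r v)).potential (q / 16 + 1) ≤
      ((4 * q : ℕ) : ℝ) ^ N * (8191 / 8192 * σ.potential (q / 16 + 1)) := by
  set k := 4 * q
  set F := P.filter fun v => σ.start v = none
  have hcardF : P.card ≤ F.card + σ.joined.card := by
    refine (Finset.card_le_card fun v hv => ?_).trans (Finset.card_union_le F σ.joined)
    by_cases h : σ.start v = none <;> simp [F, joined, h, hv]
  have hφ := σ.potential_nonneg (q / 16 + 1)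
  have hsum : ∑ r : Fin N → Fin k, (σ.next B P t fun v => partOf (r v)).potential (q / 16 + 1) ≤
      ∑ r : Fin N → Fin k, (σ.potential (q / 16 + 1) -
        if Isolates F r then σ.potential (q / 16 + 1) / 2 else 0) := by
    refine Finset.sum_le_sum fun r _ => (σ.potential_next_le B t P _).trans ?_
    by_cases h : Isolates F r
    · rw [if_pos h, if_pos (joins_of_isolates t h)]
    · rw [if_neg h]
      split_ifs <;> linarith
  refine hsum.trans ?_
  have hcount : ∑ r : Fin N → Fin k,
      (if Isolates F r then σ.potential (q / 16 + 1) / 2 else 0) =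
      (Finset.univ.filter fun r : Fin N → Fin k => Isolates F r).card *
        (σ.potential (q / 16 + 1) / 2) := by
    rw [← Finset.sum_filter, Finset.sum_const, nsmul_eq_mul]
  rw [Finset.sum_sub_distrib, hcount]
  simp only [Finset.sum_const, Finset.card_univ, Fintype.card_fun, Fintype.card_fin, nsmul_eq_mul]
  by_cases hg : σ.joined.card < q / 16 + 1
  · have hF : (k : ℝ) ^ N / 4096 ≤ (Finset.univ.filter fun r : Fin N → Fin k =>
        Isolates F r).card := card_isolates (q := q) F (by omega)
      ((Finset.card_le_card (Finset.filter_subset _ _)).trans hq) (by omega)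
    have := mul_le_mul_of_nonneg_right hF (div_nonneg hφ zero_le_two)
    push_cast
    linarith
  · simp [potential, hg]

/-- A bound for the number of sets of at most `q` identifiers, by giving every set `P` the weight
`x ^ P.card` with `x = 2 ^ (-l)`, so that `N * x ≤ q`. -/
theorem card_small_sets_le {q l : ℕ} (hN : N ≤ 2 ^ l * q) :
    ((Finset.univ.filter fun P : Finset (Fin N) => P.card ≤ q).card : ℝ) ≤
      2 ^ (l * q) * 4 ^ q := by
  have hx : (0 : ℝ) < (1 / 2) ^ l := by positivity
  have hNx : (N : ℝ) * (1 / 2) ^ l ≤ q := by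
    have : (N : ℝ) ≤ 2 ^ l * q := by exact_mod_cast hN
    calc (N : ℝ) * (1 / 2) ^ l ≤ 2 ^ l * q * (1 / 2) ^ l := by gcongr
      _ = (2 * (1 / 2)) ^ l * q := by rw [mul_pow]; ring
      _ = q := by norm_num
  have h1 : ∀ P ∈ Finset.univ.filter (fun P : Finset (Fin N) => P.card ≤ q),
      (1 : ℝ) ≤ 2 ^ (l * q) * ((1 / 2) ^ l) ^ P.card := by
    intro P hP
    have hP' := (Finset.mem_filter.1 hP).2
    calc (1 : ℝ) = 2 ^ (l * q) * ((1 / 2) ^ l) ^ q := by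
          rw [← pow_mul, ← mul_pow]
          norm_num
      _ ≤ 2 ^ (l * q) * ((1 / 2) ^ l) ^ P.card := by
          gcongr ?_ * ?_
          exact pow_le_pow_of_le_one hx.le (pow_le_one₀ (by norm_num) (by norm_num)) hP'
  calc ((Finset.univ.filter fun P : Finset (Fin N) => P.card ≤ q).card : ℝ)
      = ∑ P ∈ Finset.univ.filter (fun P : Finset (Fin N) => P.card ≤ q), (1 : ℝ) := by simp
    _ ≤ ∑ P ∈ Finset.univ.filter (fun P : Finset (Fin N) => P.card ≤ q),
          2 ^ (l * q) * ((1 / 2 : ℝ) ^ l) ^ P.card := Finset.sum_le_sum h1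
    _ ≤ ∑ P : Finset (Fin N), 2 ^ (l * q) * ((1 / 2 : ℝ) ^ l) ^ P.card :=
        Finset.sum_le_sum_of_subset_of_nonneg (Finset.filter_subset _ _)
          fun P _ _ => by positivity
    _ = 2 ^ (l * q) * ((1 / 2 : ℝ) ^ l + 1) ^ N := by
        rw [← Finset.mul_sum]
        congr 1
        have := Fintype.sum_pow_mul_eq_add_pow (Fin N) ((1 / 2 : ℝ) ^ l) 1
        simpa using this
    _ ≤ 2 ^ (l * q) * Real.exp q := by
        gcongr
        calc ((1 / 2 : ℝ) ^ l + 1) ^ N ≤ Real.exp ((1 / 2 : ℝ) ^ l) ^ N := by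
              gcongr
              exact Real.add_one_le_exp _
          _ = Real.exp (N * (1 / 2 : ℝ) ^ l) := (Real.exp_nat_mul _ _).symm
          _ ≤ Real.exp q := Real.exp_le_exp.2 hNx
    _ ≤ 2 ^ (l * q) * 4 ^ q := by
        gcongr
        calc Real.exp q = Real.exp 1 ^ q := by rw [← Real.exp_nat_mul, mul_one]
          _ ≤ 4 ^ q := by
              gcongr
              linarith [Real.exp_one_lt_d9]

/-- The decay of the potential over the whole schedule beats the number of small sets; the length
`65536 = 8 * 8192` per unit of `l * q` is chosen for this. -/
theorem decay_lt {q l : ℕ} (hq : 2 ≤ q) (hl : 1 ≤ l) :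
    2 * ((8191 / 8192 : ℝ) ^ (65536 * l * q) * (2 ^ (l * q) * 4 ^ q)) <
      (1 / 2) ^ (q / 16 + 1) := by
  have hbase : (8191 / 8192 : ℝ) ^ 8192 ≤ 1 / 2 := by
    have h1 : (8191 / 8192 : ℝ) ≤ Real.exp (-(1 / 8192)) := by
      have := Real.add_one_le_exp (-(1 / 8192 : ℝ))
      linarith
    calc (8191 / 8192 : ℝ) ^ 8192 ≤ Real.exp (-(1 / 8192)) ^ 8192 :=
          pow_le_pow_left₀ (by norm_num) h1 _
      _ = Real.exp (-1) := by
          rw [← Real.exp_nat_mul]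
          norm_num
      _ ≤ 1 / 2 := by linarith [Real.exp_neg_one_lt_d9]
  have hm : q ≤ l * q := Nat.le_mul_of_pos_left q hl
  have e : 65536 * l * q = 8192 * (8 * (l * q)) := by ring
  rw [e]
  generalize l * q = m at hm
  rw [pow_mul]
  have h4 : (4 : ℝ) ^ q = 2 ^ (2 * q) := by
    rw [pow_mul]
    norm_num
  calc 2 * (((8191 / 8192 : ℝ) ^ 8192) ^ (8 * m) * (2 ^ m * 4 ^ q))
      ≤ 2 * ((1 / 2 : ℝ) ^ (8 * m) * (2 ^ m * 4 ^ q)) := by gcongr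
    _ = 2 ^ (1 + m + 2 * q) * (1 / 2) ^ (8 * m) := by
        rw [h4, pow_add, pow_add]
        ring
    _ < 2 ^ (1 + m + 2 * q) * (1 / 2) ^ (1 + m + 2 * q + (q / 16 + 1)) := by
        gcongr 2 ^ (1 + m + 2 * q) * ?_
        exact pow_lt_pow_right_of_lt_one₀ (by norm_num) (by norm_num) (by omega)
    _ = (1 / 2) ^ (q / 16 + 1) := by
        rw [pow_add _ (1 + m + 2 * q), ← mul_assoc, ← mul_pow]
        norm_num

/-- The growth of the expected weight `2 ^ (number of active slots)` of a device. -/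
theorem growth_le {q : ℕ} (l : ℕ) (hq : 1 ≤ q) :
    (1 + 2 / ((4 * q : ℕ) : ℝ)) ^ (65536 * l * q) ≤ 2 ^ (65536 * l) := by
  have hq0 : (0 : ℝ) < q := by exact_mod_cast hq
  have h1 : (1 + 2 / ((4 * q : ℕ) : ℝ)) ^ q ≤ 2 := by
    calc (1 + 2 / ((4 * q : ℕ) : ℝ)) ^ q ≤ Real.exp (2 / ((4 * q : ℕ) : ℝ)) ^ q := by
          gcongr
          linarith [Real.add_one_le_exp (2 / ((4 * q : ℕ) : ℝ))]
      _ = Real.exp (1 / 2) := by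
          rw [← Real.exp_nat_mul]
          congr 1
          push_cast
          field_simp
          norm_num
      _ ≤ 2 := by
          have h := Real.exp_one_lt_d9
          have h2 : Real.exp (1 / 2) * Real.exp (1 / 2) = Real.exp 1 := by
            rw [← Real.exp_add]
            norm_num
          nlinarith [Real.exp_pos (1 / 2)]
  rw [mul_comm (65536 * l) q, pow_mul]
  exact pow_le_pow_left₀ (by positivity) h1 _

/-- There is a schedule of `65536 * l * q` rows of parts under which many devices join the queue,
whatever the set `P` of participants is, as long as its size is between `q / 4` and `q`. At the same
time, only few devices are active more often than `65540 * l` times. -/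
theorem exists_schedule {q l : ℕ} (B : ℕ) (hq : 2 ≤ q) (hl : 1 ≤ l) (hN : N < 2 ^ l * q) :
    ∃ part : ℕ → Fin N → Part,
      (∀ P : Finset (Fin N), 2 ≤ P.card → P.card ≤ q → q < 4 * P.card →
        q / 16 + 1 ≤ (Queue.run B P part (65536 * l * q)).joined.card) ∧
      4 * (Finset.univ.filter fun v => 65540 * l ≤
        ((Finset.range (65536 * l * q)).filter fun t => part t v ≠ .sleep).card).card ≤ q := by
  set k := 4 * q with hk
  have hk2 : 2 ≤ k := by omega
  have hk0 : (0 : ℝ) < k := by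
    have : 0 < k := by omega
    exact_mod_cast this
  have : Nonempty (Fin k) := ⟨⟨0, by omega⟩⟩
  set 𝓕 := Finset.univ.filter fun P : Finset (Fin N) => 2 ≤ P.card ∧ P.card ≤ q ∧ q < 4 * P.card
  set A : ℝ := 2 ^ (l * q) * 4 ^ q with hA
  have hA0 : 0 < A := by positivity
  set β : ℝ := 1 + 2 / k with hβ
  have hβ0 : 0 < β := by positivity
  -- The state consists of the queues of all sets and the numbers of active slots of all devices.
  let f : ℕ → (Finset (Fin N) → Queue N) × (Fin N → ℕ) → (Fin N → Fin k) →
      (Finset (Fin N) → Queue N) × (Fin N → ℕ) := fun t s r =>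
    (fun P => (s.1 P).next B P t fun v => partOf (r v),
      fun v => s.2 v + if partOf (r v) = .sleep then 0 else 1)
  -- Both terms are normalized so that they do not grow on average and start with at most `1`.
  let W : ℕ → (Finset (Fin N) → Queue N) × (Fin N → ℕ) → ℝ := fun t s =>
    (∑ P ∈ 𝓕, (s.1 P).potential (q / 16 + 1)) / ((8191 / 8192) ^ t * A) +
      (∑ v, (2 : ℝ) ^ s.2 v) / (β ^ t * (N + 1))
  have hW : ∀ t s, ∑ r, W (t + 1) (f t s r) ≤ Fintype.card (Fin N → Fin k) * W t s := by
    intro t s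
    simp only [W, f]
    rw [Finset.sum_add_distrib, ← Finset.sum_div, ← Finset.sum_div, Finset.sum_comm,
      mul_add (Fintype.card (Fin N → Fin k) : ℝ)]
    rw [Finset.sum_comm (s := (Finset.univ : Finset (Fin N → Fin k))) (t := Finset.univ)]
    simp only [Fintype.card_fun, Fintype.card_fin, Nat.cast_pow]
    refine add_le_add ?_ (le_of_eq ?_)
    · calc (∑ P ∈ 𝓕, ∑ r : Fin N → Fin k, ((s.1 P).next B P t fun v => partOf (r v)).potential
              (q / 16 + 1)) / ((8191 / 8192) ^ (t + 1) * A)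
          ≤ (∑ P ∈ 𝓕, (k : ℝ) ^ N * (8191 / 8192 * (s.1 P).potential (q / 16 + 1))) /
            ((8191 / 8192) ^ (t + 1) * A) := by
            gcongr with P hP
            obtain ⟨-, h2, hPq, h4⟩ := Finset.mem_filter.1 hP
            exact Queue.sum_potential_next_le B t (s.1 P) h2 hPq h4
        _ = _ := by
            rw [← Finset.mul_sum, ← Finset.mul_sum, pow_succ]
            field_simp
    · have : ∀ v, ∑ r : Fin N → Fin k,
          (2 : ℝ) ^ (s.2 v + if partOf (r v) = .sleep then 0 else 1) =
          2 ^ s.2 v * ((k : ℝ) ^ N * β) := by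
        intro v
        rw [← sum_row_weight hk2 v, Finset.mul_sum]
        refine Finset.sum_congr rfl fun r _ => ?_
        split_ifs <;> simp [pow_succ]
      rw [Finset.sum_congr rfl fun v _ => this v, ← Finset.sum_mul, pow_succ]
      field_simp
  obtain ⟨r, s, hs0, hs, hWs⟩ := exists_choices_of_sum_le f W hW
    (fun _ => Queue.empty, fun _ => 0)
  have hrun : ∀ P t, (s t).1 P = Queue.run B P (fun t v => partOf (r t v)) t := by
    intro P t
    induction t with
    | zero => rw [hs0]; rfl
    | succ t ih => rw [hs, Queue.run, ← ih]
  have hactive : ∀ v t, (s t).2 v =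
      ((Finset.range t).filter fun t => partOf (r t v) ≠ .sleep).card := by
    intro v t
    induction t with
    | zero => rw [hs0]; rfl
    | succ t ih =>
      rw [hs, Finset.range_add_one, Finset.filter_insert]
      simp only [f, ih]
      by_cases h : partOf (r t v) = .sleep <;> simp [h]
  have hW0 : W 0 (fun _ => Queue.empty, fun _ => 0) ≤ 2 := by
    have h1 : (𝓕.card : ℝ) ≤ A := by
      refine le_trans ?_ (card_small_sets_le hN.le)
      exact_mod_cast Finset.card_le_card (t := Finset.univ.filter fun P : Finset (Fin N) => P.card ≤ q)
        fun P (hP : P ∈ 𝓕) => Finset.mem_filter.2 ⟨Finset.mem_univ P, (Finset.mem_filter.1 hP).2.2.1⟩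
    have h2 : (𝓕.card : ℝ) / A ≤ 1 := (div_le_one hA0).2 h1
    have h3 : (N : ℝ) / (N + 1) ≤ 1 := (div_le_one (by positivity)).2 (by linarith)
    simp only [W, Queue.potential, Queue.joined, Queue.empty]
    simp
    linarith
  have hWT := (hWs (65536 * l * q)).trans hW0
  simp only [W] at hWT
  have hpos1 : 0 ≤ (∑ P ∈ 𝓕, ((s (65536 * l * q)).1 P).potential (q / 16 + 1)) /
      ((8191 / 8192) ^ (65536 * l * q) * A) :=
    div_nonneg (Finset.sum_nonneg fun P _ => Queue.potential_nonneg _ _) (by positivity)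
  have hpos2 : 0 ≤ (∑ v, (2 : ℝ) ^ (s (65536 * l * q)).2 v) /
      (β ^ (65536 * l * q) * (N + 1)) := by positivity
  refine ⟨fun t v => partOf (r t v), fun P h2 hPq h4 => ?_, ?_⟩
  · by_contra hlt
    push Not at hlt
    rw [← hrun] at hlt
    have h1 := (div_le_iff₀ (by positivity)).1 (show _ ≤ (2 : ℝ) by linarith only [hWT, hpos2] :
      (∑ P ∈ 𝓕, ((s (65536 * l * q)).1 P).potential (q / 16 + 1)) /
      ((8191 / 8192) ^ (65536 * l * q) * A) ≤ 2)
    have h3 : ((s (65536 * l * q)).1 P).potential (q / 16 + 1) ≤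
        ∑ P ∈ 𝓕, ((s (65536 * l * q)).1 P).potential (q / 16 + 1) :=
      Finset.single_le_sum (f := fun P => ((s (65536 * l * q)).1 P).potential (q / 16 + 1))
        (fun P _ => Queue.potential_nonneg _ _)
        (Finset.mem_filter.2 ⟨Finset.mem_univ P, h2, hPq, h4⟩)
    rw [Queue.potential, if_pos hlt] at h3
    have h5 : (1 / 2 : ℝ) ^ (q / 16 + 1) ≤ (1 / 2) ^ ((s (65536 * l * q)).1 P).joined.card :=
      pow_le_pow_of_le_one (by norm_num) (by norm_num) hlt.le
    linarith only [h1, h3, h5, decay_lt hq hl]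
  · simp only [← hactive]
    set O := Finset.univ.filter fun v => 65540 * l ≤ (s (65536 * l * q)).2 v
    have h1 := (div_le_iff₀ (by positivity)).1 (show _ ≤ (2 : ℝ) by linarith only [hWT, hpos1] :
      (∑ v, (2 : ℝ) ^ (s (65536 * l * q)).2 v) / (β ^ (65536 * l * q) * (N + 1)) ≤ 2)
    have h2 : (O.card : ℝ) * 2 ^ (65540 * l) ≤ ∑ v, (2 : ℝ) ^ (s (65536 * l * q)).2 v := by
      calc (O.card : ℝ) * 2 ^ (65540 * l) = ∑ v ∈ O, (2 : ℝ) ^ (65540 * l) := by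
            rw [Finset.sum_const, nsmul_eq_mul]
        _ ≤ ∑ v ∈ O, (2 : ℝ) ^ (s (65536 * l * q)).2 v := by
            refine Finset.sum_le_sum fun v hv => ?_
            exact pow_le_pow_right₀ (by norm_num) (Finset.mem_filter.1 hv).2
        _ ≤ _ := Finset.sum_le_sum_of_subset_of_nonneg (Finset.subset_univ _)
            fun v _ _ => by positivity
    have h3 : ((N : ℝ) + 1) ≤ 2 ^ l * q := by exact_mod_cast hN
    have h4 : (O.card : ℝ) * 2 ^ (65540 * l) ≤ 2 * (2 ^ (65536 * l) * (2 ^ l * q)) := by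
      refine h2.trans (h1.trans ?_)
      have := growth_le (q := q) l (by omega)
      gcongr
    have e1 : (2 : ℝ) ^ (65540 * l) = 2 ^ (65536 * l) * (2 ^ l * 2 ^ (3 * l)) := by
      rw [← pow_add, ← pow_add]
      congr 1
      ring
    have h5 : (O.card : ℝ) * 2 ^ (3 * l) ≤ 2 * q := by
      rw [e1] at h4
      have hp : (0 : ℝ) < 2 ^ (65536 * l) * 2 ^ l := by positivity
      refine le_of_mul_le_mul_left ?_ hp
      calc _ = (O.card : ℝ) * (2 ^ (65536 * l) * (2 ^ l * 2 ^ (3 * l))) := by ring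
        _ ≤ _ := h4
        _ = _ := by ring
    have h6 : (8 : ℝ) ≤ 2 ^ (3 * l) := by
      calc (8 : ℝ) = 2 ^ 3 := by norm_num
        _ ≤ 2 ^ (3 * l) := pow_le_pow_right₀ (by norm_num) (by omega)
    have h7 : (O.card : ℝ) * 8 ≤ 2 * q := le_trans (by gcongr) h5
    have h8 : O.card * 8 ≤ 2 * q := by exact_mod_cast h7
    omega

/-! ### The election -/

/-- The algorithm for `q ≥ 2`, where `2 ^ l` bounds the ratio of `N` and `q`. -/
theorem exists_algorithm_of_two_le {N q l : ℕ} (hq : 2 ≤ q) (hl : 1 ≤ l) (hN : N < 2 ^ l * q) :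
    ∃ A : Algorithm N, ∀ S : Finset (Fin N), q < 2 * S.card → S.card ≤ q →
      A.ElectsLeader S (4 * (65536 * l * q) + 1) ∧
      ∀ v ∈ S, A.energy S (4 * (65536 * l * q) + 1) v ≤ 2 ^ 23 * l := by
  set T := 65536 * l * q with hT
  -- The duties of `q / 16 + 1` devices cover more than `T` slots.
  set B := 16 * (65536 * l) with hB
  obtain ⟨part, hjoin, hload⟩ := exists_schedule (N := N) B hq hl hN
  rw [← hT] at hjoin hload
  -- Overloaded devices take no part in the election.
  set O := Finset.univ.filter fun v => 65540 * l ≤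
    ((Finset.range T).filter fun t => part t v ≠ .sleep).card with hO
  let part' : ℕ → Fin N → Part := fun t v => if v ∈ O then .sleep else part t v
  refine ⟨queueAlgorithm B T part', fun S hS hSq => ⟨electsLeader ?_, fun v hv => ?_⟩⟩
  · have hrun : Queue.run B S part' T = Queue.run B (S \ O) part T := by
      refine Queue.run_congr (fun t v x hx => ?_) T
      by_cases hv : v ∈ O
      · simp [part', hv, hx.symm]
      · simp [part', hv]
    have hcard : S.card ≤ (S \ O).card + O.card := by
      have := Finset.le_card_sdiff O S
      omega
    have hle : (S \ O).card ≤ S.card := Finset.card_le_card Finset.sdiff_subset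
    have hG := hjoin (S \ O) (by omega) (by omega) (by omega)
    rw [hrun]
    refine lt_of_lt_of_le ?_ (Queue.valid_run B (S \ O) part T).tail_ge
    calc T = 65536 * l * q := hT
      _ < 65536 * l * (16 * (q / 16 + 1)) := by
          gcongr
          omega
      _ = B * (q / 16 + 1) := by rw [hB]; ring
      _ ≤ _ := by gcongr
  · refine (energy_le v).trans ?_
    have hact : ((Finset.range T).filter fun t => part' t v ≠ .sleep).card ≤ 65540 * l := by
      by_cases hvO : v ∈ O
      · simp [part', hvO]
      · have : ¬ 65540 * l ≤ ((Finset.range T).filter fun t => part t v ≠ .sleep).card := by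
          simpa [hO] using hvO
        simpa [part', hvO] using (not_le.1 this).le
    omega

/-- A single device elects itself by transmitting once. -/
theorem exists_algorithm_of_card_eq_one (N : ℕ) : ∃ A : Algorithm N, ∀ S : Finset (Fin N),
    S.card = 1 → A.ElectsLeader S 1 ∧ ∀ v ∈ S, A.energy S 1 v ≤ 1 := by
  refine ⟨⟨fun _ h => if h = [] then none else some .leader, fun _ _ => .transmit []⟩,
    fun S hS => ⟨⟨one_pos, fun t ht v _ => ?_, ?_⟩, fun v _ => ?_⟩⟩
  · obtain rfl : t = 0 := by omega
    rfl
  · obtain ⟨l, rfl⟩ := Finset.card_eq_one.1 hS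
    refine ⟨l, by simp, rfl, ⟨[], rfl⟩, fun v hv hvl => absurd (by simpa using hv) hvl⟩
  · exact (Finset.card_filter_le _ _).trans (by simp)

end MultipleAccess

theorem theorem3 :
    ∃ C : ℝ, 0 < C ∧
      ∀ N n' : ℕ, ∃ A : MultipleAccess.Algorithm N,
        ∀ S : Finset (Fin N), (n' : ℝ) / 2 < (S.card : ℝ) → S.card ≤ n' →
          ∃ T : ℕ, A.ElectsLeader S T ∧
            (T : ℝ) ≤ C * ((S.card : ℝ) * max 1 (Real.logb 2 ((N : ℝ) / (S.card : ℝ)))) ∧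
            ∀ v ∈ S, (A.energy S T v : ℝ) ≤
              C * max 1 (Real.logb 2 ((N : ℝ) / (S.card : ℝ))) := by
  refine ⟨2 ^ 24, by norm_num, fun N n' => ?_⟩
  rcases Nat.lt_or_ge n' 2 with hn' | hn'
  · obtain ⟨A, hA⟩ := MultipleAccess.exists_algorithm_of_card_eq_one N
    refine ⟨A, fun S hS hSn => ?_⟩
    have hcard : S.card = 1 := by
      have h0 : (0 : ℝ) < S.card := lt_of_le_of_lt (by positivity) hS
      have h0' : 0 < S.card := by exact_mod_cast h0
      omega
    have hΛ := le_max_left 1 (Real.logb 2 ((N : ℝ) / (S.card : ℝ)))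
    obtain ⟨h1, h2⟩ := hA S hcard
    refine ⟨1, h1, ?_, fun v hv => ?_⟩
    · rw [hcard] at hΛ ⊢
      push_cast at hΛ ⊢
      linarith
    · have : ((A.energy S 1 v : ℕ) : ℝ) ≤ 1 := by exact_mod_cast h2 v hv
      linarith
  · have hlog : N < 2 ^ (Nat.log 2 (N / n') + 1) * n' :=
      (Nat.div_lt_iff_lt_mul (by omega)).1 (Nat.lt_pow_succ_log_self (by norm_num) _)
    obtain ⟨A, hA⟩ := MultipleAccess.exists_algorithm_of_two_le hn' (Nat.le_add_left 1 _) hlog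
    refine ⟨A, fun S hS hSn => ?_⟩
    have hS2 : (n' : ℝ) < 2 * S.card := by linarith
    have hS2' : n' < 2 * S.card := by exact_mod_cast hS2
    obtain ⟨h1, h2⟩ := hA S hS2' hSn
    set Λ := max 1 (Real.logb 2 ((N : ℝ) / (S.card : ℝ))) with hΛdef
    have hΛ : 1 ≤ Λ := le_max_left _ _
    have hs1 : (1 : ℝ) ≤ S.card := by
      have : 1 ≤ S.card := by omega
      exact_mod_cast this
    have hl : ((Nat.log 2 (N / n') + 1 : ℕ) : ℝ) ≤ 2 * Λ := by
      have : (Nat.log 2 (N / n') : ℝ) ≤ Λ := by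
        rcases Nat.eq_zero_or_pos (N / n') with h0 | h0
        · rw [h0]
          simp
          linarith
        · refine le_trans ?_ (le_max_right _ _)
          rw [Real.le_logb_iff_rpow_le (by norm_num), Real.rpow_natCast]
          · have e1 : ((2 ^ Nat.log 2 (N / n') : ℕ) : ℝ) ≤ ((N / n' : ℕ) : ℝ) := by
              exact_mod_cast Nat.pow_log_le_self 2 h0.ne'
            push_cast at e1
            refine e1.trans (Nat.cast_div_le.trans ?_)
            gcongr
          · have : 0 < N := Nat.pos_of_ne_zero fun h => by simp [h] at h0
            positivity
      push_cast
      linarith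
    generalize Nat.log 2 (N / n') + 1 = l at *
    refine ⟨_, h1, ?_, fun v hv => ?_⟩
    · push_cast
      have h3 : (l : ℝ) * n' ≤ (2 * Λ) * (2 * S.card) := by gcongr
      have h4 : 1 ≤ (S.card : ℝ) * Λ := by nlinarith
      nlinarith
    · have h3 : ((A.energy S (4 * (65536 * l * n') + 1) v : ℕ) : ℝ) ≤ 2 ^ 23 * l := by
        exact_mod_cast h2 v hv
      linarith
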